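/- Let $k$ be a field and let $H\subseteq\mathbb N$ be a numerical semigroup (a submonoid of $\mathbb N$ with finite complement) with multiplicity $a=\min(H\setminus\{0\})$ and embedding dimension $n\ge 3$ (the number of elements of the minimal system of generators of $H$). Let $k[H]=k[t^x \mid x\in H]\subseteq k[t]$, let $\mathfrak m=(t^x\mid 0<x\in H)$ be its graded maximal ideal, and let $\mathrm{gr}(k[H])=\bigoplus_{i\ge 0}\mathfrak m^i/\mathfrak m^{i+1}$. Assume that * $H$ has almost maximal embedding dimension, that is, $\ell := a-n+1=2$; * $k[H]/(t^a)$ is a stretched Artinian local ring, that is, the square of its maximal ideal is principal (possibly zero); * the set $\mathrm{PF}(H)=\{z\in\mathbb Z\setminus H \mid z+x\in H \text{ for all } 0<x\in H\}$ of pseudo-Frobenius numbers equals $\{h+\alpha,h+2\alpha,\dots,h+(n-1)\alpha\}$ for some integers $h\ge 0$ and $\alpha>0$. Then there is a unique $j\in\{1,\dots,n-1\}$ such that $b:=\frac{h+j\alpha+a}{2}$ is an integer and $$\{a,b\}\cup\bigl(\{h+\alpha+a,\,h+2\alpha+a,\,\dots,\,h+(n-1)\alpha+a\}\setminus\{h+j\alpha+a\}\bigr)$$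 is the minimal system of generators of $H$. Moreover, with this $j$ and $b$, the ring $\mathrm{gr}(k[H])$ is not Cohen–Macaulay if and only if $j=1$ and $h=b=a+\alpha$. -/

import Mathlib

open Polynomial

/-! ### Numerical semigroups -/

namespace NumSgp

/-- A numerical semigroup: a submonoid of `ℕ` with finite complement
(equivalently, a submonoid generated by positive integers of greatest common divisor `1`). -/
def IsNumericalSemigroup (H : AddSubmonoid ℕ) : Prop :=
  (H : Set ℕ)ᶜ.Finite

/-- The multiplicity `min (H \ {0})`. -/
noncomputable def mult (H : AddSubmonoid ℕ) : ℕ :=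
  sInf {x : ℕ | x ∈ H ∧ x ≠ 0}

/-- The minimal system of generators of `H`: the nonzero elements of `H` that are not a sum of two
nonzero elements of `H`. -/
def minGens (H : AddSubmonoid ℕ) : Set ℕ :=
  {x : ℕ | x ∈ H ∧ x ≠ 0 ∧ ∀ y ∈ H, ∀ z ∈ H, y ≠ 0 → z ≠ 0 → x ≠ y + z}

/-- The embedding dimension: the number of minimal generators. -/
noncomputable def embDim (H : AddSubmonoid ℕ) : ℕ :=
  (minGens H).ncard

/-- The set of integers `z` that lie in `H`. -/
def intSet (H : AddSubmonoid ℕ) : Set ℤ :=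
  (fun x : ℕ => (x : ℤ)) '' (H : Set ℕ)

/-- The pseudo-Frobenius numbers of `H`: integers `z ∉ H` such that `z + x ∈ H` for all
`0 < x ∈ H`. -/
def PF (H : AddSubmonoid ℕ) : Set ℤ :=
  {z : ℤ | z ∉ intSet H ∧ ∀ x ∈ H, 0 < x → z + (x : ℤ) ∈ intSet H}

/-- The index `j` (with `b = (h + j α + a) / 2`) is such that
`{a, b} ∪ ({h + α + a, …, h + (n - 1) α + a} \ {h + j α + a})` is the minimal system of generators
of `H`. -/
def IsGenIndex (H : AddSubmonoid ℕ) (n a h α j b : ℕ) : Prop :=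
  1 ≤ j ∧ j ≤ n - 1 ∧ 2 * b = h + j * α + a ∧
    minGens H =
      {a, b} ∪ ((fun i : ℕ => h + i * α + a) '' Set.Icc 1 (n - 1)) \ {h + j * α + a}

/-! ### The semigroup ring -/

/-- The semigroup ring `k[H] ⊆ k[t]`: the `k`-subalgebra generated by the monomials `t ^ x` with
`x ∈ H` (equivalently, with `x` in a generating system of `H`). -/
noncomputable def semigroupRing (k : Type*) [Field k] (H : AddSubmonoid ℕ) : Subalgebra k k[X] :=
  Algebra.adjoin k ((fun x : ℕ => (X : k[X]) ^ x) '' (H : Set ℕ))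

/-- The graded maximal ideal of `k[H]`, generated by the `t ^ x` with `0 < x ∈ H`. -/
noncomputable def gradedMaxIdeal (k : Type*) [Field k] (H : AddSubmonoid ℕ) :
    Ideal (semigroupRing k H) :=
  Ideal.span {f | ∃ x ∈ H, 0 < x ∧ (f : k[X]) = X ^ x}

/-- The ideal `(t ^ a)` of `k[H]`, for `a ∈ H`. -/
noncomputable def monomialIdeal (k : Type*) [Field k] (H : AddSubmonoid ℕ) (a : ℕ) :
    Ideal (semigroupRing k H) :=
  Ideal.span {f | (f : k[X]) = X ^ a}

end NumSgp

/-! ### Commutative algebra -/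

/-- A stretched Artinian local ring: the square of the maximal ideal is principal (possibly `0`). -/
def IsStretchedArtinianLocal (A : Type*) [CommRing A] : Prop :=
  IsArtinianRing A ∧ ∃ _ : IsLocalRing A, ((IsLocalRing.maximalIdeal A) ^ 2).IsPrincipal

/-- The associated graded ring `⨁ I ^ i / I ^ (i + 1)`, as the quotient of the Rees algebra
`R[I t] = ⨁ I ^ i t ^ i` by its ideal `I R[I t] = ⨁ I ^ (i + 1) t ^ i`. -/
abbrev AssocGradedRing {R : Type*} [CommRing R] (I : Ideal R) : Type _ :=
  reesAlgebra I ⧸ I.map (algebraMap R (reesAlgebra I))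

/-- A Noetherian local ring is Cohen-Macaulay if its depth equals its dimension, i.e. its maximal
ideal contains a regular sequence whose length is the Krull dimension. -/
def IsCohenMacaulayLocal (R : Type*) [CommRing R] [IsLocalRing R] : Prop :=
  IsNoetherianRing R ∧ ∃ rs : List R, (∀ r ∈ rs, r ∈ IsLocalRing.maximalIdeal R) ∧
    RingTheory.Sequence.IsRegular R rs ∧ (rs.length : WithBot ℕ∞) = ringKrullDim R

/-- A Noetherian ring is Cohen-Macaulay if its localization at each maximal ideal is. -/
def IsCohenMacaulay (R : Type*) [CommRing R] : Prop :=
  IsNoetherianRing R ∧ ∀ (P : Ideal R) [P.IsMaximal],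
    IsCohenMacaulayLocal (Localization.AtPrime P)

/-! Since ℓ = 2 means a = n + 1, the Apéry set of `H` with respect to `a` has n nonzero elements.
The shifted pseudo-Frobenius numbers h + iα + a give n - 1 of them; let b be the remaining one. As b
- a is not pseudo-Frobenius, some b + x with x ≠ 0 stays in the Apéry set, and x can only be b. So
2b is the one nonzero Apéry element that is not a minimal generator, and it equals some h + jα + a
(`exists_structure`, `existsUnique_genIndex`).

For the tangent cone, write M for the nonzero elements of `H` and 3b = a + g with g in M. A sum of
two elements of M lies in a + M unless both are b, so 3b is the only possible obstruction to (i+1)M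
= a + iM for i ≥ 2. If g is not a minimal generator, then g ∈ 2M, these equalities hold, and the
initial form of t^a is regular on gr. If g is a minimal generator, its initial form is nonzero, yet
it is killed by that of t^a because a + g = 3b ∈ 3M. Finally, g is a minimal generator exactly when
j = 1 and h = b = a + α, by counting residues modulo a (`mem_minGens_iff`).

The passage to Cohen–Macaulayness uses that gr is k[T] plus nilpotents, with T the initial form of
t^a. It then has dimension one, and Cohen–Macaulayness is decided by torsion over k[T]
(`isCohenMacaulay_of_torsionFree`, `not_isCohenMacaulay_of_annihilated`). -/

section PolynomialModNilpotents

/-! ### Cohen–Macaulayness of rings that are k[X] up to nilpotents. -/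

variable {k G : Type*} [Field k] [CommRing G] (ψ : k[X] →+* G)

/-- The elements that are congruent to a value of `ψ` modulo the nilradical. -/
def rangeAddNilpotents : AddSubmonoid G where
  carrier := {z | ∃ p ν, IsNilpotent ν ∧ z = ψ p + ν}
  zero_mem' := ⟨0, 0, IsNilpotent.zero, by simp⟩
  add_mem' := by
    rintro _ _ ⟨p, ν, hν, rfl⟩ ⟨q, μ, hμ, rfl⟩
    exact ⟨p + q, ν + μ, (Commute.all _ _).isNilpotent_add hν hμ, by rw [map_add]; ring⟩

theorem map_mem_rangeAddNilpotents (p : k[X]) : ψ p ∈ rangeAddNilpotents ψ :=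
  ⟨p, 0, IsNilpotent.zero, by simp⟩

theorem mul_mem_rangeAddNilpotents {ν : G} (hν : IsNilpotent ν) (z : G) :
    z * ν ∈ rangeAddNilpotents ψ :=
  ⟨0, z * ν, (Commute.all _ _).isNilpotent_mul_left hν, by simp⟩

/-- Modulo its nilradical, `G` is the domain k[X]. -/
theorem nilradical_isPrime_of_exists_add_nilpotent (hψ : Function.Injective ψ)
    (hs : ∀ z, z ∈ rangeAddNilpotents ψ) : (nilradical G).IsPrime := by
  have key : ∀ p ν, IsNilpotent ν → (ψ p + ν ∈ nilradical G ↔ p = 0) := by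
    intro p ν hν
    rw [(nilradical G).add_mem_iff_left (mem_nilradical.2 hν), mem_nilradical]
    rw [IsNilpotent.map_iff hψ, isNilpotent_iff_eq_zero]
  refine ⟨fun h => ?_, fun {x y} hxy => ?_⟩
  · have h1 := (key 1 0 IsNilpotent.zero).1 (h ▸ Submodule.mem_top)
    exact one_ne_zero h1
  · obtain ⟨p, ν, hν, rfl⟩ := hs x
    obtain ⟨q, μ, hμ, rfl⟩ := hs y
    rw [key p ν hν, key q μ hμ, ← mul_eq_zero]
    rw [← mem_nilradical] at hν hμ
    have e : (ψ p + ν) * (ψ q + μ) = ψ (p * q) + (ν * (ψ q + μ) + ψ p * μ) := by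
      rw [map_mul]; ring
    rw [e] at hxy
    exact (key _ _ (mem_nilradical.1 (Ideal.add_mem _ (Ideal.mul_mem_right _ _ hν)
      (Ideal.mul_mem_left _ _ hμ)))).1 hxy

/-- At a maximal ideal `P` containing the annihilator of `g`, every element of `P` has a power
killing `g`, so the localization has depth zero. Its dimension is positive, because the nilradical
is a prime that misses `ψ X ∈ P`. -/
theorem not_isCohenMacaulay_of_annihilated (hψ : Function.Injective ψ)
    (hs : ∀ z, z ∈ rangeAddNilpotents ψ) (g : G) (hg : g ≠ 0)
    (hXg : ψ X * g = 0) : ¬ IsCohenMacaulay G := by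
  rintro ⟨-, hCM⟩
  set A : Ideal G := LinearMap.ker (LinearMap.toSpanSingleton G G g) with hA
  have memA : ∀ z, z ∈ A ↔ z * g = 0 := fun z => by simp [hA]
  have hAtop : A ≠ ⊤ := fun h => hg (by simpa using (memA 1).1 (h ▸ Submodule.mem_top))
  obtain ⟨P, hPmax, hAP⟩ := A.exists_le_maximal hAtop
  have hP := hPmax.isPrime
  have hXP : ψ X ∈ P := hAP ((memA _).2 hXg)
  have kill : ∀ r ∈ P, ∃ m, r ^ m * g = 0 := by
    intro r hr
    obtain ⟨p, ν, ⟨m, hm⟩, rfl⟩ := hs r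
    have hνP : ν ∈ P := hP.mem_of_pow_mem m (hm ▸ P.zero_mem)
    have hpP : ψ p ∈ P := (P.add_mem_iff_left hνP).1 hr
    -- A nonzero constant term would be a unit in `P`.
    have hp0 : p.coeff 0 = 0 := by
      by_contra h0
      have e := congrArg ψ p.divX_mul_X_add
      rw [map_add, map_mul] at e
      have hC : ψ (C (p.coeff 0)) ∈ P := by
        rw [← e] at hpP
        exact (P.add_mem_iff_right (P.mul_mem_left _ hXP)).1 hpP
      refine hP.ne_top (P.eq_top_of_isUnit_mem hC ?_)
      exact ((isUnit_C.2 (isUnit_iff_ne_zero.2 h0))).map ψ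
    have hpg : ψ p * g = 0 := by
      obtain ⟨q, rfl⟩ := X_dvd_iff.2 hp0
      rw [map_mul, mul_right_comm, hXg, zero_mul]
    refine ⟨m, ?_⟩
    have : ∀ i, (ψ p + ν) ^ i * g = ν ^ i * g := by
      intro i
      induction i with
      | zero => simp
      | succ i ih =>
        calc (ψ p + ν) ^ (i + 1) * g = (ψ p + ν) ^ i * (ψ p * g) + ν * ((ψ p + ν) ^ i * g) := by
              ring
          _ = ν ^ (i + 1) * g := by rw [hpg, ih]; ring
    rw [this, hm, zero_mul]
  obtain ⟨-, rs, hrs, hreg, hlen⟩ := hCM P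
  cases rs with
  | nil =>
    rw [IsLocalization.AtPrime.ringKrullDim_eq_height P] at hlen
    have h0 : P.height = 0 := by
      have : ((0 : ℕ∞) : WithBot ℕ∞) = (P.height : WithBot ℕ∞) := by simpa using hlen
      exact (WithBot.coe_injective this).symm
    rw [Ideal.height_eq_zero_iff] at h0
    have hn := nilradical_isPrime_of_exists_add_nilpotent ψ hψ hs
    have := h0.2 ⟨hn, bot_le⟩ (nilradical_le_prime P) hXP
    rw [mem_nilradical, IsNilpotent.map_iff hψ, isNilpotent_iff_eq_zero] at this
    exact X_ne_zero this
  | cons y ys =>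
    have hy := ((RingTheory.Sequence.isRegular_cons_iff _ _ _).1 hreg).1
    have hyP := hrs y List.mem_cons_self
    obtain ⟨⟨r, s⟩, hrs⟩ := IsLocalization.surj P.primeCompl y
    have hrP : r ∈ P := by
      rw [← IsLocalization.AtPrime.to_map_mem_maximal_iff (Localization.AtPrime P) P]
      simp only at hrs
      rw [← hrs]
      exact Ideal.mul_mem_right _ _ hyP
    obtain ⟨m, hm⟩ := kill r hrP
    have h1 : y ^ m • (algebraMap G (Localization.AtPrime P) (s ^ m * g)) = 0 := by
      simp only at hrs
      rw [smul_eq_mul, map_mul, map_pow, ← mul_assoc, ← mul_pow, hrs, ← map_pow, ← map_mul, hm,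
        map_zero]
    have h2 := (hy.pow m).right_eq_zero_of_smul h1
    rw [IsLocalization.map_eq_zero_iff P.primeCompl] at h2
    obtain ⟨u, hu⟩ := h2
    rw [← mul_assoc] at hu
    exact (u * s ^ m).2 (hAP ((memA _).2 hu))

/-- Every maximal ideal contains some `ψ f` with `f ≠ 0`, which is a nonzerodivisor, and it has
height one; so `ψ f` alone is a regular sequence of the right length. -/
theorem isCohenMacaulay_of_torsionFree [IsNoetherianRing G]
    (hs : ∀ z, z ∈ rangeAddNilpotents ψ)
    (htf : ∀ f : k[X], f ≠ 0 → ∀ z, ψ f * z = 0 → z = 0) : IsCohenMacaulay G := by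
  have hreg : ∀ f : k[X], f ≠ 0 → ψ f ∈ nonZeroDivisors G := fun f hf =>
    mem_nonZeroDivisors_iff_left.2 (htf f hf)
  refine ⟨inferInstance, fun P hPmax => ⟨inferInstance, ?_⟩⟩
  have hP := hPmax.isPrime
  have nilP : ∀ (Q : Ideal G), Q.IsPrime → ∀ ν, IsNilpotent ν → ν ∈ Q := fun Q hQ ν hν =>
    (nilradical_le_prime Q) (mem_nilradical.2 hν)
  -- Otherwise inverses modulo `P`, corrected by nilpotents, would make k[X] a field.
  obtain ⟨f, hf0, hfP⟩ : ∃ f : k[X], f ≠ 0 ∧ ψ f ∈ P := by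
    by_contra! hcon
    apply Polynomial.not_isField k
    refine ⟨⟨0, 1, zero_ne_one⟩, mul_comm, fun {a} ha => ?_⟩
    obtain ⟨y, z, hz, hyz⟩ := hPmax.exists_inv (hcon a ha)
    obtain ⟨p, ν, hν, rfl⟩ := hs y
    refine ⟨p, ?_⟩
    by_contra hne
    apply hcon (a * p - 1) (sub_ne_zero.2 hne)
    have : ψ (a * p - 1) = -z - ν * ψ a := by
      rw [map_sub, map_mul, map_one, ← hyz]; ring
    rw [this]
    exact P.sub_mem (P.neg_mem hz) (P.mul_mem_right _ (nilP P hP ν hν))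
  have hht : P.height = 1 := by
    apply le_antisymm
    -- A prime between (ψ f) and `P` has the same contraction to k[X], by maximality of nonzero
    -- primes there, and contains the same nilpotents; hence it is `P`. Krull's principal ideal
    -- theorem then applies.
    · have hmin : P ∈ (Ideal.span {ψ f}).minimalPrimes := by
        refine ⟨⟨hP, by simpa [Ideal.span_le] using hfP⟩, ?_⟩
        rintro q ⟨hq, hfq⟩ hqP r hr
        have hfq : ψ f ∈ q := hfq (Ideal.mem_span_singleton_self _)
        have hq' : (q.comap ψ).IsPrime := hq.comap ψ
        have hmax : (q.comap ψ).IsMaximal :=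
          hq'.isMaximal (fun h => hf0 (by
            have : f ∈ q.comap ψ := hfq
            rwa [h, Ideal.mem_bot] at this))
        have heq : q.comap ψ = P.comap ψ :=
          hmax.eq_of_le (hP.comap ψ).ne_top (Ideal.comap_mono hqP)
        obtain ⟨p, ν, hν, rfl⟩ := hs r
        have hp : p ∈ P.comap ψ := (P.add_mem_iff_left (nilP P hP ν hν)).1 hr
        rw [← heq] at hp
        exact q.add_mem hp (nilP q hq ν hν)
      exact Ideal.height_le_one_of_isPrincipal_of_mem_minimalPrimes _ _ hmin
    · rw [Order.one_le_iff_ne_zero, Ne, Ideal.height_eq_zero_iff]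
      exact fun h => (Ideal.disjoint_nonZeroDivisors_of_mem_minimalPrimes h).le_bot
        ⟨hfP, hreg f hf0⟩
  have hmem : algebraMap G (Localization.AtPrime P) (ψ f) ∈
      IsLocalRing.maximalIdeal (Localization.AtPrime P) :=
    (IsLocalization.AtPrime.to_map_mem_maximal_iff (Localization.AtPrime P) P _).2 hfP
  refine ⟨[algebraMap G _ (ψ f)], by simpa using hmem, ?_, ?_⟩
  · rw [IsLocalRing.isRegular_iff_isWeaklyRegular_of_subset_maximalIdeal (by simpa using hmem),
      RingTheory.Sequence.isWeaklyRegular_singleton_iff]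
    have : algebraMap G (Localization.AtPrime P) (ψ f) ∈
        nonZeroDivisors (Localization.AtPrime P) :=
      IsLocalization.map_nonZeroDivisors_le P.primeCompl _ ⟨_, hreg f hf0, rfl⟩
    intro x y hxy
    exact (mul_cancel_left_mem_nonZeroDivisors this).1 hxy
  · rw [IsLocalization.AtPrime.ringKrullDim_eq_height P, hht]
    rfl

end PolynomialModNilpotents

namespace NumSgp

/-! ### Apéry sets -/

/-- The Apéry set of `H` with respect to `a`. -/
def aperySet (H : AddSubmonoid ℕ) (a : ℕ) : Set ℕ :=
  {s | s ∈ H ∧ ∀ z ∈ H, s ≠ a + z}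

/-- The `i`-fold sumset `i M = M + ⋯ + M` of the maximal ideal `M = H \ {0}`, with `0 M = H`. -/
def idealPow (H : AddSubmonoid ℕ) : ℕ → Set ℕ
  | 0 => H
  | i + 1 => {x | ∃ y ∈ H, y ≠ 0 ∧ ∃ z ∈ idealPow H i, x = y + z}

variable {H : AddSubmonoid ℕ} {a : ℕ}

theorem zero_mem_aperySet (ha0 : a ≠ 0) : 0 ∈ aperySet H a :=
  ⟨H.zero_mem, fun z _ => by omega⟩

theorem eq_of_modEq_of_mem_aperySet (haH : a ∈ H) {s t : ℕ} (hs : s ∈ aperySet H a)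
    (ht : t ∈ aperySet H a) (hst : s ≡ t [MOD a]) : s = t := by
  have key : ∀ {s t : ℕ}, s ∈ aperySet H a → t ∈ aperySet H a → s ≡ t [MOD a] → ¬ s < t := by
    intro s t hs ht hst hlt
    obtain ⟨c, hc⟩ := (Nat.modEq_iff_dvd' hlt.le).1 hst
    cases c with
    | zero => simp at hc; omega
    | succ c =>
      refine ht.2 (c • a + s) (H.add_mem (H.nsmul_mem haH c) hs.1) ?_
      rw [smul_eq_mul]
      have : t = a * (c + 1) + s := by omega
      rw [this]; ring
  have h1 := key hs ht hst
  have h2 := key ht hs hst.symm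
  omega

/-- The least element of `H` in a residue class is an Apéry element; the class meets `H` because the
complement is finite. -/
theorem exists_mem_aperySet_modEq (hH : IsNumericalSemigroup H) (ha0 : a ≠ 0) (r : ℕ) :
    ∃ s ∈ aperySet H a, s ≡ r [MOD a] := by
  classical
  have hex : ∃ s, s ∈ H ∧ s ≡ r [MOD a] := by
    by_contra! hcon
    refine Set.infinite_of_injective_forall_mem (f := fun m : ℕ => r + a * m)
      (fun m m' h => ?_) (fun m => ?_) hH
    · simpa [ha0] using h
    · exact fun hm => hcon _ hm (by simp [Nat.ModEq])
  refine ⟨Nat.find hex, ⟨(Nat.find_spec hex).1, fun z hz hzeq => ?_⟩, (Nat.find_spec hex).2⟩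
  refine Nat.find_min hex (m := z) (by omega) ⟨hz, ?_⟩
  have := (Nat.find_spec hex).2
  rw [hzeq] at this
  simpa [Nat.ModEq] using this

theorem bijOn_mod_aperySet (hH : IsNumericalSemigroup H) (haH : a ∈ H) (ha0 : a ≠ 0) :
    Set.BijOn (· % a) (aperySet H a) (Set.Iio a) := by
  refine ⟨fun s _ => Nat.mod_lt _ (Nat.pos_of_ne_zero ha0),
    fun s hs t ht hst => eq_of_modEq_of_mem_aperySet haH hs ht hst, fun r hr => ?_⟩
  obtain ⟨s, hs, hsr⟩ := exists_mem_aperySet_modEq (H := H) hH ha0 r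
  exact ⟨s, hs, by simpa [Nat.ModEq, Nat.mod_eq_of_lt (Set.mem_Iio.1 hr)] using hsr⟩

theorem finite_aperySet (hH : IsNumericalSemigroup H) (haH : a ∈ H) (ha0 : a ≠ 0) :
    (aperySet H a).Finite :=
  (bijOn_mod_aperySet hH haH ha0).finite_iff_finite.2 (Set.finite_Iio a)

theorem ncard_aperySet (hH : IsNumericalSemigroup H) (haH : a ∈ H) (ha0 : a ≠ 0) :
    (aperySet H a).ncard = a := by
  have h := bijOn_mod_aperySet hH haH ha0
  rw [← h.injOn.ncard_image, h.image_eq, ← Nat.card_coe_set_eq]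
  simp

theorem mult_spec (hH : IsNumericalSemigroup H) : mult H ∈ H ∧ mult H ≠ 0 := by
  have : {x : ℕ | x ∈ H ∧ x ≠ 0}.Nonempty := by
    by_contra hcon
    rw [Set.not_nonempty_iff_eq_empty] at hcon
    refine (Set.finite_singleton 0).infinite_compl (hH.subset fun x hx hxH => ?_)
    have : x ∈ {x : ℕ | x ∈ H ∧ x ≠ 0} := ⟨hxH, hx⟩
    rw [hcon] at this
    exact this
  exact Nat.sInf_mem this

theorem mult_le {x : ℕ} (hx : x ∈ H) (hx0 : x ≠ 0) : mult H ≤ x :=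
  Nat.sInf_le ⟨hx, hx0⟩

theorem mult_mem_minGens (hH : IsNumericalSemigroup H) : mult H ∈ minGens H := by
  refine ⟨(mult_spec hH).1, (mult_spec hH).2, fun y hy z hz hy0 hz0 h => ?_⟩
  have := mult_le hy hy0
  omega

theorem mem_aperySet_of_mem_minGens {x : ℕ} (haH : a ∈ H) (ha0 : a ≠ 0) (hx : x ∈ minGens H)
    (hxa : x ≠ a) : x ∈ aperySet H a :=
  ⟨hx.1, fun z hz h => hx.2.2 a haH z hz ha0 (fun h0 => hxa (by simpa [h0] using h)) h⟩

theorem closure_minGens (H : AddSubmonoid ℕ) : AddSubmonoid.closure (minGens H) = H := by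
  apply le_antisymm (AddSubmonoid.closure_le.2 fun x hx => hx.1)
  intro x
  induction x using Nat.strong_induction_on with
  | _ x ih =>
    intro hx
    by_cases hx0 : x = 0
    · exact hx0 ▸ zero_mem _
    by_cases hg : x ∈ minGens H
    · exact AddSubmonoid.subset_closure hg
    · have : ∃ y ∈ H, ∃ z ∈ H, y ≠ 0 ∧ z ≠ 0 ∧ x = y + z := by
        by_contra! hcon
        exact hg ⟨hx, hx0, hcon⟩
      obtain ⟨y, hy, z, hz, hy0, hz0, rfl⟩ := this
      exact add_mem (ih y (by omega) hy) (ih z (by omega) hz)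

theorem natCast_mem_intSet {x : ℕ} : (x : ℤ) ∈ intSet H ↔ x ∈ H := by
  simp [intSet]

/-! ### Almost maximal embedding dimension and arithmetic pseudo-Frobenius numbers -/

/-- The numerical hypotheses: `H` has multiplicity `a = n + 1`, where `n` is the embedding dimension,
and its pseudo-Frobenius numbers are `h + i α` for `1 ≤ i ≤ n - 1`. -/
structure ArithmeticPF (H : AddSubmonoid ℕ) (n a h α : ℕ) : Prop where
  num : IsNumericalSemigroup H
  embDim_eq : embDim H = n
  three_le : 3 ≤ n
  mult_eq : mult H = a
  mult_eq_succ : a = n + 1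
  pos : 0 < α
  pf_eq : PF H = (fun i : ℕ => (h : ℤ) + (i : ℤ) * (α : ℤ)) '' Set.Icc 1 (n - 1)

/-- The elements `h + i α + a`, for `1 ≤ i ≤ n - 1`. -/
def shiftedPF (n a h α : ℕ) : Set ℕ :=
  (fun i : ℕ => h + i * α + a) '' Set.Icc 1 (n - 1)

theorem finite_shiftedPF (n a h α : ℕ) : (shiftedPF n a h α).Finite :=
  (Set.finite_Icc _ _).image _

theorem ncard_shiftedPF (n a h : ℕ) {α : ℕ} (hα : 0 < α) : (shiftedPF n a h α).ncard = n - 1 := by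
  rw [shiftedPF, Set.ncard_image_of_injective, ← Nat.card_coe_set_eq]
  · simp
  · intro i j hij
    have : i * α = j * α := by simp only at hij; omega
    exact Nat.eq_of_mul_eq_mul_right hα this

namespace ArithmeticPF

variable {n h α : ℕ} (A : ArithmeticPF H n a h α)

include A

theorem mem : a ∈ H := A.mult_eq ▸ (mult_spec A.num).1

theorem ne_zero : a ≠ 0 := A.mult_eq ▸ (mult_spec A.num).2

theorem le {x : ℕ} (hx : x ∈ H) (hx0 : x ≠ 0) : a ≤ x := A.mult_eq ▸ mult_le hx hx0

theorem mem_minGens : a ∈ minGens H := A.mult_eq ▸ mult_mem_minGens A.num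

theorem mem_shiftedPF_iff {x : ℕ} : x ∈ shiftedPF n a h α ↔ (x : ℤ) - a ∈ PF H := by
  rw [A.pf_eq]
  constructor
  · rintro ⟨i, hi, rfl⟩
    exact ⟨i, hi, by push_cast; ring⟩
  · rintro ⟨i, hi, hx⟩
    refine ⟨i, hi, ?_⟩
    have : ((h + i * α + a : ℕ) : ℤ) = x := by push_cast; simp only at hx; linarith
    exact_mod_cast this

theorem exists_add_eq_of_mem_shiftedPF {x y : ℕ} (hx : x ∈ shiftedPF n a h α) (hy : y ∈ H)
    (hy0 : y ≠ 0) : ∃ z ∈ H, x + y = a + z := by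
  obtain ⟨z, hz, hzeq⟩ := (A.mem_shiftedPF_iff.1 hx).2 y hy (Nat.pos_of_ne_zero hy0)
  exact ⟨z, hz, by simp only at hzeq; omega⟩

theorem shiftedPF_subset : shiftedPF n a h α ⊆ aperySet H a \ {0} := by
  intro x hx
  have h1 := A.mem_shiftedPF_iff.1 hx
  have hxa : x ≠ 0 := by
    obtain ⟨i, hi, rfl⟩ := hx
    have := A.ne_zero
    simp only
    omega
  refine ⟨⟨?_, fun z hz hxz => h1.1 ?_⟩, hxa⟩
  · have := h1.2 a A.mem (Nat.pos_of_ne_zero A.ne_zero)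
    rw [sub_add_cancel] at this
    exact natCast_mem_intSet.1 this
  · rw [hxz]; push_cast; rw [add_sub_cancel_left]; exact natCast_mem_intSet.2 hz

theorem ncard_aperySet_diff : (aperySet H a \ {0}).ncard = n := by
  rw [Set.ncard_sdiff_singleton_of_mem (zero_mem_aperySet A.ne_zero),
    ncard_aperySet A.num A.mem A.ne_zero, A.mult_eq_succ, Nat.add_sub_cancel]

theorem exists_eq_insert : ∃ b, b ∉ shiftedPF n a h α ∧
    aperySet H a \ {0} = insert b (shiftedPF n a h α) := by
  have h1 : ((aperySet H a \ {0}) \ shiftedPF n a h α).ncard = 1 := by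
    rw [Set.ncard_sdiff A.shiftedPF_subset (finite_shiftedPF _ _ _ _), A.ncard_aperySet_diff,
      ncard_shiftedPF _ _ _ A.pos]
    have := A.three_le
    omega
  obtain ⟨b, hb⟩ := Set.ncard_eq_one.1 h1
  have hbm : b ∈ (aperySet H a \ {0}) \ shiftedPF n a h α := hb ▸ rfl
  refine ⟨b, hbm.2, ?_⟩
  rw [Set.insert_eq, ← hb, Set.sdiff_union_of_subset A.shiftedPF_subset]

/-- The n - 1 minimal generators other than `a` lie among the n nonzero Apéry elements, so exactly
one of these is missed. -/
theorem exists_minGens_eq : ∃ w, w ∈ aperySet H a \ {0} ∧ w ∉ minGens H ∧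
    minGens H = insert a ((aperySet H a \ {0}) \ {w}) := by
  have hfin : (aperySet H a \ {0}).Finite := (finite_aperySet A.num A.mem A.ne_zero).sdiff
  have hsub : minGens H \ {a} ⊆ aperySet H a \ {0} := fun x hx =>
    ⟨mem_aperySet_of_mem_minGens A.mem A.ne_zero hx.1 hx.2, hx.1.2.1⟩
  have hcard : (minGens H \ {a}).ncard = n - 1 := by
    rw [Set.ncard_sdiff_singleton_of_mem A.mem_minGens, ← A.embDim_eq, embDim]
  have h1 : ((aperySet H a \ {0}) \ (minGens H \ {a})).ncard = 1 := by
    rw [Set.ncard_sdiff hsub (hfin.subset hsub), A.ncard_aperySet_diff, hcard]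
    have := A.three_le
    omega
  obtain ⟨w, hw⟩ := Set.ncard_eq_one.1 h1
  have hwm : w ∈ (aperySet H a \ {0}) \ (minGens H \ {a}) := hw ▸ rfl
  have hwa : w ≠ a := fun h => hwm.1.1.2 0 H.zero_mem (by simpa using h)
  refine ⟨w, hwm.1, fun hmem => hwm.2 ⟨hmem, hwa⟩, ?_⟩
  rw [← hw, Set.sdiff_sdiff_cancel_left hsub, Set.insert_sdiff_singleton,
    Set.insert_eq_of_mem A.mem_minGens]

theorem exists_structure : ∃ b, b ∈ H ∧ a < b ∧ b ∉ shiftedPF n a h α ∧ 2 * b ∈ shiftedPF n a h α ∧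
    aperySet H a \ {0} = insert b (shiftedPF n a h α) ∧
    minGens H = {a, b} ∪ shiftedPF n a h α \ {2 * b} := by
  obtain ⟨b, hb, hAp⟩ := A.exists_eq_insert
  obtain ⟨w, hw, hwg, hgens⟩ := A.exists_minGens_eq
  have hbA : b ∈ aperySet H a \ {0} := hAp ▸ Set.mem_insert b _
  have hbH : b ∈ H := hbA.1.1
  have hba : a < b := lt_of_le_of_ne (A.le hbH hbA.2)
    fun h => hbA.1.2 0 H.zero_mem (by simpa using h.symm)
  have h2b : w = 2 * b := by
    have h1 : ¬ ((b : ℤ) - a ∈ PF H) := fun h => hb (A.mem_shiftedPF_iff.2 h)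
    have h2 : (b : ℤ) - a ∉ intSet H := by
      rintro ⟨z, hz, hzeq⟩
      exact hbA.1.2 z hz (by simp only at hzeq; omega)
    -- A witness that b - a is not pseudo-Frobenius: `x` must be an Apéry element, and the shifted
    -- pseudo-Frobenius numbers are excluded because adding any nonzero element of `H` to them
    -- leaves the Apéry set.
    have h3 : ∃ x ∈ H, 0 < x ∧ (b : ℤ) - a + x ∉ intSet H := by
      by_contra! hcon
      exact h1 ⟨h2, hcon⟩
    obtain ⟨x, hx, hx0, hbx⟩ := h3
    have nobx : ∀ z ∈ H, b + x ≠ a + z := fun z hz h =>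
      hbx ⟨z, hz, by simp only; omega⟩
    have hxA : x ∈ aperySet H a \ {0} := by
      refine ⟨⟨hx, fun z hz h => nobx (b + z) (H.add_mem hbH hz) (by omega)⟩, ?_⟩
      simp only [Set.mem_singleton_iff]; omega
    have hxb : x = b := by
      rw [hAp] at hxA
      refine hxA.resolve_right fun hxW => ?_
      obtain ⟨z, hz, hzeq⟩ := A.exists_add_eq_of_mem_shiftedPF hxW hbH hbA.2
      exact nobx z hz (by omega)
    subst hxb
    by_contra hne
    have : x + x ∈ minGens H := by
      rw [hgens]
      refine Or.inr ⟨⟨⟨H.add_mem hx hx, nobx⟩, ?_⟩, ?_⟩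
      · simp only [Set.mem_singleton_iff]; omega
      · simp only [Set.mem_singleton_iff]; omega
    exact this.2.2 x hx x hx hx0.ne' hx0.ne' rfl
  subst h2b
  have hbne : b ≠ 2 * b := by have := hbA.2; simp only [Set.mem_singleton_iff] at this; omega
  refine ⟨b, hbH, hba, hb, ?_, hAp, ?_⟩
  · rw [hAp] at hw
    exact hw.resolve_left hbne.symm
  · rw [hgens, hAp, Set.insert_sdiff_of_notMem _ (by simpa using hbne : b ∉ ({2 * b} : Set ℕ))]
    ext x
    simp only [Set.mem_insert_iff, Set.mem_union, Set.mem_singleton_iff, or_assoc]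

theorem existsUnique_genIndex : ∃! p : ℕ × ℕ, IsGenIndex H n a h α p.1 p.2 := by
  obtain ⟨b, hbH, hba, hb, h2b, hAp, hgens⟩ := A.exists_structure
  have hn2b : 2 * b ∉ minGens H := fun hmem =>
    hmem.2.2 b hbH b hbH (by omega) (by omega) (two_mul b)
  have h2b' := h2b
  obtain ⟨j, hj, hjb⟩ := h2b'
  simp only at hjb
  refine ⟨(j, b), ⟨hj.1, hj.2, hjb.symm, ?_⟩, ?_⟩
  · simp only
    rw [hjb]; exact hgens
  · rintro ⟨j', b'⟩ ⟨h1, h2, h3, h4⟩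
    simp only at h1 h2 h3 h4
    -- If b' ≠ b, then 2b would survive in the second list and be a minimal generator.
    have hbb : b' = b := by
      by_contra hne
      apply hn2b
      rw [h4]
      refine Or.inr ⟨h2b, ?_⟩
      simp only [Set.mem_singleton_iff]; omega
    subst hbb
    have : j' * α = j * α := by omega
    rw [Nat.eq_of_mul_eq_mul_right A.pos this]

/-- The consequences of the hypotheses used for the tangent cone. -/
theorem of_isGenIndex {j b : ℕ} (hjb : IsGenIndex H n a h α j b) :
    b ∈ H ∧ a < b ∧ b ∉ shiftedPF n a h α ∧ 2 * b ∈ shiftedPF n a h α ∧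
    aperySet H a \ {0} = insert b (shiftedPF n a h α) ∧
    minGens H = {a, b} ∪ shiftedPF n a h α \ {2 * b} := by
  obtain ⟨b', hb'⟩ := A.exists_structure
  have hb'' := hb'
  obtain ⟨hbH, hba, -, ⟨j', hj', hjb'⟩, -, hgens⟩ := hb''
  simp only at hjb'
  have h1 : IsGenIndex H n a h α j' b' := ⟨hj'.1, hj'.2, hjb'.symm, hjb' ▸ hgens⟩
  have := (A.existsUnique_genIndex.unique (y₁ := (j, b)) (y₂ := (j', b')) hjb h1)
  obtain rfl : b = b' := (Prod.ext_iff.1 this).2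
  exact hb'

end ArithmeticPF

end NumSgp

/-! ### Sumsets of M and cancellation of `a`. -/

namespace NumSgp

variable {H : AddSubmonoid ℕ} {a : ℕ}

theorem add_mem_idealPow {i : ℕ} {x y : ℕ} (hx : x ∈ H) (hy : y ∈ idealPow H i) :
    x + y ∈ idealPow H i := by
  induction i generalizing y with
  | zero => exact H.add_mem hx hy
  | succ i ih =>
    obtain ⟨u, hu, hu0, v, hv, rfl⟩ := hy
    exact ⟨u, hu, hu0, x + v, ih hv, by omega⟩

theorem idealPow_one_iff {x : ℕ} : x ∈ idealPow H 1 ↔ x ∈ H ∧ x ≠ 0 := by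
  constructor
  · rintro ⟨u, hu, hu0, v, hv, rfl⟩
    exact ⟨H.add_mem hu hv, by omega⟩
  · rintro ⟨hx, hx0⟩
    exact ⟨x, hx, hx0, 0, H.zero_mem, rfl⟩

theorem idealPow_two_iff {x : ℕ} : x ∈ idealPow H 2 ↔ x ∈ H ∧ x ≠ 0 ∧ x ∉ minGens H := by
  constructor
  · rintro ⟨u, hu, hu0, v, hv, rfl⟩
    rw [idealPow_one_iff] at hv
    exact ⟨H.add_mem hu hv.1, by omega, fun hg => hg.2.2 u hu v hv.1 hu0 hv.2 rfl⟩
  · rintro ⟨hx, hx0, hg⟩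
    have : ∃ y ∈ H, ∃ z ∈ H, y ≠ 0 ∧ z ≠ 0 ∧ x = y + z := by
      by_contra! hcon
      exact hg ⟨hx, hx0, hcon⟩
    obtain ⟨y, hy, z, hz, hy0, hz0, rfl⟩ := this
    exact ⟨y, hy, hy0, z, idealPow_one_iff.2 ⟨hz, hz0⟩, rfl⟩

theorem idealPow_anti {i j : ℕ} (hij : i ≤ j) : idealPow H j ⊆ idealPow H i := by
  induction hij with
  | refl => exact subset_rfl
  | step _ ih =>
    rintro x ⟨u, hu, -, v, hv, rfl⟩
    exact add_mem_idealPow hu (ih hv)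

theorem mul_le_of_mem_idealPow {i x : ℕ} (hx : x ∈ idealPow H i) : i * mult H ≤ x := by
  induction i generalizing x with
  | zero => omega
  | succ i ih =>
    obtain ⟨u, hu, hu0, v, hv, rfl⟩ := hx
    have := ih hv
    have := mult_le hu hu0
    rw [add_mul]
    omega

namespace ArithmeticPF

variable {n h α j b : ℕ} (A : ArithmeticPF H n a h α) (hjb : IsGenIndex H n a h α j b)

include A hjb

theorem exists_add_eq {x y : ℕ} (hx : x ∈ H) (hx0 : x ≠ 0) (hy : y ∈ H) (hy0 : y ≠ 0)
    (hxb : x ≠ b) : ∃ z ∈ H, z ≠ 0 ∧ x + y = a + z := by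
  have hxa := A.le hx hx0
  have hya := A.le hy hy0
  have ha := A.ne_zero
  suffices ∃ z ∈ H, x + y = a + z by
    obtain ⟨z, hz, hzeq⟩ := this
    exact ⟨z, hz, by omega, hzeq⟩
  obtain ⟨-, -, -, -, hAp, -⟩ := A.of_isGenIndex hjb
  by_cases hxA : x ∈ aperySet H a
  · have hxA' : x ∈ aperySet H a \ {0} := ⟨hxA, hx0⟩
    rw [hAp] at hxA'
    exact A.exists_add_eq_of_mem_shiftedPF (hxA'.resolve_left hxb) hy hy0
  · have : ∃ z ∈ H, x = a + z := by
      by_contra! hcon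
      exact hxA ⟨hx, hcon⟩
    obtain ⟨z, hz, rfl⟩ := this
    exact ⟨z + y, H.add_mem hz hy, by omega⟩

theorem exists_three_mul_eq : ∃ g ∈ H, g ≠ 0 ∧ 3 * b = a + g := by
  obtain ⟨hbH, hba, -, -, -, -⟩ := A.of_isGenIndex hjb
  obtain ⟨g, hg, hg0, hgeq⟩ := A.exists_add_eq hjb (H.add_mem hbH hbH) (by omega) hbH (by omega)
    (by omega)
  exact ⟨g, hg, hg0, by omega⟩

/-- In a sum of three elements of M, a summand other than `b` lets `a` be split off at the cost of
one summand. Only b + b + b remains, and there g ∈ 2M is needed. -/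
theorem exists_of_mem_idealPow_three {g : ℕ} (hg : g ∈ H) (hg0 : g ≠ 0) (hgb : 3 * b = a + g)
    (hgm : g ∉ minGens H) (i : ℕ) {x : ℕ} (hx : x ∈ idealPow H (i + 3)) :
    ∃ z ∈ idealPow H (i + 2), x = a + z := by
  induction i generalizing x with
  | zero =>
    obtain ⟨u, hu, hu0, y, ⟨v, hv, hv0, w, hw, rfl⟩, rfl⟩ := hx
    rw [idealPow_one_iff] at hw
    have two : ∀ {p q : ℕ}, p ∈ H → p ≠ 0 → q ∈ H → q ≠ 0 → p + q ∈ idealPow H 2 :=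
      fun hp hp0 hq hq0 => ⟨_, hp, hp0, _, idealPow_one_iff.2 ⟨hq, hq0⟩, rfl⟩
    by_cases hub : u = b
    · by_cases hvb : v = b
      · by_cases hwb : w = b
        · exact ⟨g, idealPow_two_iff.2 ⟨hg, hg0, hgm⟩, by omega⟩
        · obtain ⟨z, hz, hz0, hzeq⟩ := A.exists_add_eq hjb hw.1 hw.2 hv hv0 hwb
          exact ⟨u + z, two hu hu0 hz hz0, by omega⟩
      · obtain ⟨z, hz, hz0, hzeq⟩ := A.exists_add_eq hjb hv hv0 hw.1 hw.2 hvb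
        exact ⟨u + z, two hu hu0 hz hz0, by omega⟩
    · obtain ⟨z, hz, hz0, hzeq⟩ := A.exists_add_eq hjb hu hu0 hv hv0 hub
      exact ⟨z + w, two hz hz0 hw.1 hw.2, by omega⟩
  | succ i ih =>
    obtain ⟨u, hu, hu0, y, hy, rfl⟩ := hx
    obtain ⟨z, hz, rfl⟩ := ih hy
    exact ⟨u + z, ⟨u, hu, hu0, z, hz, rfl⟩, by omega⟩

theorem mem_idealPow_of_add_mem {g : ℕ} (hg : g ∈ H) (hg0 : g ≠ 0) (hgb : 3 * b = a + g)
    (hgm : g ∉ minGens H) {i s : ℕ} (hs : s ∈ H) (has : a + s ∈ idealPow H (i + 2)) :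
    s ∈ idealPow H (i + 1) := by
  cases i with
  | zero =>
    refine idealPow_one_iff.2 ⟨hs, ?_⟩
    rintro rfl
    exact (idealPow_two_iff.1 has).2.2 A.mem_minGens
  | succ i =>
    obtain ⟨z, hz, hzeq⟩ := A.exists_of_mem_idealPow_three hjb hg hg0 hgb hgm i has
    rwa [show s = z by omega]

/-- If g = h + iα + a, then b = (i - j)α + a, so modulo a every Apéry element is a multiple of α.
These represent all residues, so α is a unit. After division by α, with e = i - j and c = 2e - j,
the residues are 0, e and c + 1, …, c + a - 2; hence c and c - 1 must be 0 and e, which forces e = j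
= 1. -/
theorem mem_minGens_iff {g : ℕ} (hgb : 3 * b = a + g) :
    g ∈ minGens H ↔ j = 1 ∧ h = b ∧ b = a + α := by
  obtain ⟨hbH, hba, -, h2b, hAp, hgens⟩ := A.of_isGenIndex hjb
  obtain ⟨hj1, hjn, hjeq, -⟩ := hjb
  have ha := A.mult_eq_succ
  have hn3 := A.three_le
  have hα := A.pos
  constructor
  · intro hg
    rw [hgens] at hg
    obtain ⟨i, hi, hieq⟩ : g ∈ shiftedPF n a h α := by
      rcases hg with (hg | hg) | hg
      · omega
      · simp only [Set.mem_singleton_iff] at hg; omega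
      · exact hg.1
    simp only at hieq
    obtain ⟨hi1, hin⟩ := hi
    -- Otherwise g ≤ 2b, that is, b ≤ a.
    have hji : j < i := by
      by_contra! hle
      have := Nat.mul_le_mul_right α hle
      omega
    obtain ⟨d, rfl⟩ := Nat.exists_eq_add_of_lt hji
    obtain ⟨e, rfl⟩ : ∃ e, e = d + 1 := ⟨_, rfl⟩
    have hb : b = (d + 1) * α + a := by
      have : (j + d + 1) * α = j * α + (d + 1) * α := by ring
      omega
    have : NeZero a := ⟨A.ne_zero⟩
    have hbZ : (b : ZMod a) = (d + 1) * α := by rw [hb]; push_cast; simp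
    have hhZ : (h : ZMod a) = (2 * (d + 1) - j) * α := by
      have : ((2 * b : ℕ) : ZMod a) = (h + j * α + a : ℕ) := by rw [hjeq]
      push_cast at this
      rw [hbZ, ZMod.natCast_self] at this
      linear_combination -this
    have hit : ∀ r : ZMod a, r = 0 ∨ r = (d + 1) * α ∨
        ∃ i : ℕ, 1 ≤ i ∧ i ≤ n - 1 ∧ r = (2 * (d + 1) - j + i) * α := by
      intro r
      obtain ⟨s, hs, hsr⟩ := exists_mem_aperySet_modEq A.num A.ne_zero r.val
      have hsr' : (s : ZMod a) = r := by
        rw [(ZMod.natCast_eq_natCast_iff _ _ _).2 hsr, ZMod.natCast_zmod_val]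
      by_cases hs0 : s = 0
      · left; rw [← hsr', hs0, Nat.cast_zero]
      have hs' : s ∈ aperySet H a \ {0} := ⟨hs, hs0⟩
      rw [hAp] at hs'
      rcases hs' with rfl | ⟨i, hi, rfl⟩
      · exact Or.inr (Or.inl (by rw [← hsr', hbZ]))
      · refine Or.inr (Or.inr ⟨i, hi.1, hi.2, ?_⟩)
        rw [← hsr']
        push_cast
        rw [hhZ, ZMod.natCast_self]
        ring
    obtain ⟨c, hc⟩ : ∃ c : ZMod a, c * α = 1 := by
      rcases hit 1 with h1 | h1 | ⟨i, -, -, h1⟩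
      · exact ⟨0, by rw [zero_mul, h1]⟩
      · exact ⟨_, h1.symm⟩
      · exact ⟨_, h1.symm⟩
    have cancel : ∀ {u v : ZMod a}, u * α = v * α → u = v := by
      intro u v huv
      calc u = u * α * c := by rw [mul_assoc, mul_comm (α : ZMod a), hc, mul_one]
        _ = v * α * c := by rw [huv]
        _ = v := by rw [mul_assoc, mul_comm (α : ZMod a), hc, mul_one]
    have ne_zero : ∀ m : ℕ, 0 < m → m < a → (m : ZMod a) ≠ 0 := by
      intro m hm hma h0
      rw [ZMod.natCast_eq_zero_iff] at h0
      exact absurd (Nat.le_of_dvd hm h0) (by omega)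
    have inj : ∀ m m' : ℕ, m < a → m' < a → (m : ZMod a) = m' → m = m' := by
      intro m m' hm hm' h
      rw [ZMod.natCast_eq_natCast_iff] at h
      exact Nat.ModEq.eq_of_lt_of_lt h hm hm'
    have e1 : (2 * (d + 1) - j : ZMod a) = 0 ∨ (2 * (d + 1) - j : ZMod a) = d + 1 := by
      rcases hit ((2 * (d + 1) - j) * α) with h1 | h1 | ⟨i, hi1, hi2, h1⟩
      · exact Or.inl (cancel (by rw [h1, zero_mul]))
      · exact Or.inr (cancel h1)
      · refine absurd ?_ (ne_zero i (by omega) (by omega))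
        linear_combination -cancel h1
    have e2 : (2 * (d + 1) - j - 1 : ZMod a) = 0 ∨ (2 * (d + 1) - j - 1 : ZMod a) = d + 1 := by
      rcases hit ((2 * (d + 1) - j - 1) * α) with h1 | h1 | ⟨i, hi1, hi2, h1⟩
      · exact Or.inl (cancel (by rw [h1, zero_mul]))
      · exact Or.inr (cancel h1)
      · refine absurd ?_ (ne_zero (i + 1) (by omega) (by omega))
        push_cast
        linear_combination -cancel h1
    have one_ne : (1 : ZMod a) ≠ 0 := by simpa using ne_zero 1 (by omega) (by omega)
    rcases e1 with e1 | e1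
    · rcases e2 with e2 | e2
      · exact absurd (by linear_combination e1 - e2) one_ne
      -- The case c = 0, c - 1 = e would need e + 1 = 0 modulo a, but e + 1 = d + 2 ≤ n - 1.
      · refine absurd ?_ (ne_zero (d + 2) (by omega) (by omega))
        push_cast
        linear_combination e1 - e2
    · rcases e2 with e2 | e2
      · have h1 : j = d + 1 := inj _ _ (by omega) (by omega) (by
          push_cast; linear_combination -e1)
        have h2 : d = 0 := inj _ _ (by omega) (by omega) (by
          push_cast; linear_combination e2 - e1)
        subst h2
        subst h1
        simp only [zero_add, one_mul] at hb hjeq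
        omega
      · exact absurd (by linear_combination e1 - e2) one_ne
  · rintro ⟨rfl, rfl, hb⟩
    rw [hgens]
    refine Or.inr ⟨⟨2, ⟨by omega, by omega⟩, ?_⟩, ?_⟩
    · simp only; omega
    · simp only [Set.mem_singleton_iff]; omega

end ArithmeticPF

end NumSgp

/-! ### Coefficients of the ideal generated by I in its Rees algebra. -/

theorem mem_map_algebraMap_reesAlgebra_iff {R : Type*} [CommRing R] {I : Ideal R}
    {F : reesAlgebra I} :
    F ∈ I.map (algebraMap R (reesAlgebra I)) ↔ ∀ i, (F : R[X]).coeff i ∈ I ^ (i + 1) := by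
  constructor
  · let K : Ideal (reesAlgebra I) :=
      { carrier := {F | ∀ i, (F : R[X]).coeff i ∈ I ^ (i + 1)}
        add_mem' := fun hF hF' i => by
          rw [Subalgebra.coe_add, coeff_add]
          exact Ideal.add_mem _ (hF i) (hF' i)
        zero_mem' := fun i => by simp
        smul_mem' := fun F' F hF i => by
          rw [smul_eq_mul, Subalgebra.coe_mul, coeff_mul]
          refine Ideal.sum_mem _ fun p hp => ?_
          rw [← Finset.HasAntidiagonal.mem_antidiagonal.1 hp, add_assoc, pow_add]
          exact Ideal.mul_mem_mul (F'.2 _) (hF _) }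
    suffices I.map (algebraMap R (reesAlgebra I)) ≤ K from fun h => this h
    rw [Ideal.map_le_iff_le_comap]
    intro r hr i
    change (C r).coeff i ∈ _
    rw [coeff_C]
    split_ifs with h
    · subst h; simpa using hr
    · exact zero_mem _
  · intro hF
    have hmono : ∀ i r, r ∈ I ^ (i + 1) →
        monomial i r ∈ ((I.map (algebraMap R (reesAlgebra I))).restrictScalars R).map
          (reesAlgebra I).val.toLinearMap := by
      intro i r hr
      rw [pow_succ'] at hr
      refine Submodule.mul_induction_on hr (fun x hx y hy => ?_) (fun x y hx hy => ?_)
      · refine ⟨algebraMap R (reesAlgebra I) x * ⟨monomial i y, reesAlgebra.monomial_mem.2 hy⟩,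
          Ideal.mul_mem_right _ _ (Ideal.mem_map_of_mem _ hx), ?_⟩
        change C x * monomial i y = _
        rw [C_mul_monomial]
      · rw [map_add]
        exact Submodule.add_mem _ hx hy
    have : (F : R[X]) ∈ ((I.map (algebraMap R (reesAlgebra I))).restrictScalars R).map
        (reesAlgebra I).val.toLinearMap := by
      rw [(F : R[X]).as_sum_support]
      exact Submodule.sum_mem _ fun i _ => hmono i _ (hF i)
    obtain ⟨F', hF', h⟩ := this
    rwa [← Subtype.ext (show (F' : R[X]) = F from h)]

/-! ### Monomial bases of k[H] and of the powers of its maximal ideal. -/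

namespace NumSgp

variable {k : Type*} [Field k] {H : AddSubmonoid ℕ}

theorem mem_semigroupRing_iff {f : k[X]} :
    f ∈ semigroupRing k H ↔ ∀ s, f.coeff s ≠ 0 → s ∈ H := by
  constructor
  · intro hf
    induction hf using Algebra.adjoin_induction with
    | mem f hf =>
      obtain ⟨x, hx, rfl⟩ := hf
      intro s hs
      rw [coeff_X_pow] at hs
      rwa [show s = x by simpa using hs]
    | algebraMap c =>
      intro s hs
      rw [Polynomial.algebraMap_apply, Algebra.algebraMap_self_apply, coeff_C] at hs
      rw [show s = 0 by by_contra h; simp [h] at hs]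
      exact H.zero_mem
    | add f g _ _ hf hg =>
      intro s hs
      rw [coeff_add] at hs
      by_cases h : f.coeff s = 0
      · exact hg s (by simpa [h] using hs)
      · exact hf s h
    | mul f g _ _ hf hg =>
      intro s hs
      rw [coeff_mul] at hs
      obtain ⟨p, hp, hne⟩ := Finset.exists_ne_zero_of_sum_ne_zero hs
      rw [← Finset.HasAntidiagonal.mem_antidiagonal.1 hp]
      exact H.add_mem (hf _ (left_ne_zero_of_mul hne)) (hg _ (right_ne_zero_of_mul hne))
  · intro hf
    rw [f.as_sum_support]
    refine Subalgebra.sum_mem _ fun s hs => ?_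
    rw [← C_mul_X_pow_eq_monomial, ← smul_eq_C_mul]
    exact Subalgebra.smul_mem _ 
      (Algebra.subset_adjoin (Set.mem_image_of_mem _ (hf s (mem_support_iff.1 hs)))) _

variable (k) in
/-- The monomial `t ^ s` of `k[H]`. -/
noncomputable def tpow {s : ℕ} (hs : s ∈ H) : semigroupRing k H :=
  ⟨X ^ s, Algebra.subset_adjoin ⟨s, hs, rfl⟩⟩

theorem tpow_mul_tpow {s u : ℕ} (hs : s ∈ H) (hu : u ∈ H) :
    tpow k hs * tpow k hu = tpow k (H.add_mem hs hu) :=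
  Subtype.ext (pow_add X s u).symm

theorem tpow_pow {s : ℕ} (hs : s ∈ H) (m : ℕ) :
    tpow k hs ^ m = tpow k (H.nsmul_mem hs m) :=
  Subtype.ext (by simp [tpow, ← pow_mul, mul_comm])

theorem tpow_congr {s u : ℕ} (hs : s ∈ H) (hu : u ∈ H) (h : s = u) : tpow k hs = tpow k hu := by
  subst h; rfl

theorem idealPow_subset (i : ℕ) : idealPow H i ⊆ H := idealPow_anti (Nat.zero_le i)

theorem tpow_mem_pow {i s : ℕ} (hs : s ∈ H) (hi : s ∈ idealPow H i) :
    tpow k hs ∈ gradedMaxIdeal k H ^ i := by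
  induction i generalizing s with
  | zero => simp
  | succ i ih =>
    obtain ⟨y, hy, hy0, z, hz, rfl⟩ := hi
    rw [← tpow_mul_tpow hy (idealPow_subset i hz), pow_succ']
    exact Ideal.mul_mem_mul (Ideal.subset_span ⟨y, hy, Nat.pos_of_ne_zero hy0, rfl⟩) (ih _ hz)

theorem mem_idealPow_of_mem_pow {i : ℕ} {r : semigroupRing k H}
    (hr : r ∈ gradedMaxIdeal k H ^ i) {s : ℕ} (hs : (r : k[X]).coeff s ≠ 0) :
    s ∈ idealPow H i := by
  have hadd : ∀ (S : Set ℕ) (f g : semigroupRing k H),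
      (∀ s, (f : k[X]).coeff s ≠ 0 → s ∈ S) → (∀ s, (g : k[X]).coeff s ≠ 0 → s ∈ S) →
      ∀ s, ((f + g : semigroupRing k H) : k[X]).coeff s ≠ 0 → s ∈ S := by
    intro S f g hf hg s hs
    rw [Subalgebra.coe_add, coeff_add] at hs
    by_cases h : (f : k[X]).coeff s = 0
    · exact hg s (by simpa [h] using hs)
    · exact hf s h
  have hmax : ∀ f ∈ gradedMaxIdeal k H, ∀ s, (f : k[X]).coeff s ≠ 0 → s ∈ H ∧ s ≠ 0 := by
    intro f hf
    induction hf using Submodule.span_induction with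
    | mem f hf =>
      obtain ⟨x, hx, hx0, hfx⟩ := hf
      intro s hs
      rw [hfx, coeff_X_pow] at hs
      rw [show s = x by simpa using hs]
      exact ⟨hx, hx0.ne'⟩
    | zero => simp
    | add f g _ _ hf hg => exact hadd {s | s ∈ H ∧ s ≠ 0} f g hf hg
    | smul r f _ hf =>
      intro s hs
      rw [smul_eq_mul, Subalgebra.coe_mul, coeff_mul] at hs
      obtain ⟨p, hp, hne⟩ := Finset.exists_ne_zero_of_sum_ne_zero hs
      have h1 := mem_semigroupRing_iff.1 r.2 _ (left_ne_zero_of_mul hne)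
      have h2 := hf _ (right_ne_zero_of_mul hne)
      rw [← Finset.HasAntidiagonal.mem_antidiagonal.1 hp]
      exact ⟨H.add_mem h1 h2.1, by omega⟩
  revert s
  induction i generalizing r with
  | zero => exact fun {s} hs => mem_semigroupRing_iff.1 r.2 s hs
  | succ i ih =>
    rw [pow_succ'] at hr
    suffices ∀ s, (r : k[X]).coeff s ≠ 0 → s ∈ idealPow H (i + 1) from fun {s} => this s
    refine Submodule.mul_induction_on hr (fun f hf g hg s hs => ?_)
      (fun f g hf hg => hadd _ f g hf hg)
    rw [Subalgebra.coe_mul, coeff_mul] at hs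
    obtain ⟨p, hp, hne⟩ := Finset.exists_ne_zero_of_sum_ne_zero hs
    have h1 := hmax f hf _ (left_ne_zero_of_mul hne)
    exact ⟨p.1, h1.1, h1.2, p.2, ih hg (right_ne_zero_of_mul hne), (Finset.HasAntidiagonal.mem_antidiagonal.1 hp).symm⟩

theorem mem_span_tpow {i : ℕ} {r : semigroupRing k H}
    (hr : ∀ s, (r : k[X]).coeff s ≠ 0 → s ∈ idealPow H i) :
    r ∈ Submodule.span k {f : semigroupRing k H | ∃ (s : ℕ) (hs : s ∈ H),
      s ∈ idealPow H i ∧ f = tpow k hs} := by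
  set N := Submodule.span k {f : semigroupRing k H | ∃ (s : ℕ) (hs : s ∈ H),
      s ∈ idealPow H i ∧ f = tpow k hs}
  have : (r : k[X]) ∈ N.map (semigroupRing k H).val.toLinearMap := by
    rw [(r : k[X]).as_sum_support]
    refine Submodule.sum_mem _ fun s hs => ?_
    have hs' := hr s (mem_support_iff.1 hs)
    rw [← C_mul_X_pow_eq_monomial, ← smul_eq_C_mul]
    refine Submodule.smul_mem _ _ ⟨tpow k (idealPow_subset i hs'), ?_, rfl⟩
    exact Submodule.subset_span ⟨s, _, hs', rfl⟩
  obtain ⟨r', hr', h⟩ := this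
  rwa [← Subtype.ext (show (r' : k[X]) = r from h)]

/-- The powers are monomial ideals, which turns questions about gr into questions about sumsets. -/
theorem mem_pow_iff {i : ℕ} {r : semigroupRing k H} :
    r ∈ gradedMaxIdeal k H ^ i ↔ ∀ s, (r : k[X]).coeff s ≠ 0 → s ∈ idealPow H i := by
  refine ⟨fun hr s hs => mem_idealPow_of_mem_pow hr hs, fun hr => ?_⟩
  have hle : Submodule.span k {f : semigroupRing k H | ∃ (s : ℕ) (hs : s ∈ H),
      s ∈ idealPow H i ∧ f = tpow k hs} ≤ (gradedMaxIdeal k H ^ i).restrictScalars k := by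
    rw [Submodule.span_le]
    rintro _ ⟨s, hs, hi, rfl⟩
    exact tpow_mem_pow hs hi
  exact hle (mem_span_tpow hr)

theorem tpow_mem_pow_iff {i s : ℕ} (hs : s ∈ H) :
    tpow k hs ∈ gradedMaxIdeal k H ^ i ↔ s ∈ idealPow H i :=
  ⟨fun h => mem_idealPow_of_mem_pow h (by simp [tpow]), tpow_mem_pow hs⟩

theorem isNoetherianRing_semigroupRing (hfin : (minGens H).Finite) :
    IsNoetherianRing (semigroupRing k H) := by
  have heq : semigroupRing k H =
      Algebra.adjoin k ((fun x : ℕ => (X : k[X]) ^ x) '' minGens H) := by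
    apply le_antisymm
    · refine Algebra.adjoin_le ?_
      rintro _ ⟨x, hx, rfl⟩
      simp only [SetLike.mem_coe] at hx ⊢
      rw [← closure_minGens H] at hx
      induction hx using AddSubmonoid.closure_induction with
      | mem x hx => exact Algebra.subset_adjoin ⟨x, hx, rfl⟩
      | zero => rw [pow_zero]; exact one_mem _
      | add x y _ _ hx hy => rw [pow_add]; exact mul_mem hx hy
    · exact Algebra.adjoin_mono (Set.image_mono fun x hx => hx.1)
  have : Algebra.FiniteType k (semigroupRing k H) := by
    rw [← Subalgebra.fg_iff_finiteType, heq]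
    exact Subalgebra.fg_def.2 ⟨_, hfin.image _, rfl⟩
  exact Algebra.FiniteType.isNoetherianRing k _

/-! ### The polynomial subring of the associated graded ring -/

section Graded

variable {a : ℕ} (ha : a ∈ H)

variable (k) in
/-- The element `t ^ s` in degree `i` of the Rees algebra of the graded maximal ideal. -/
noncomputable def reesMonomial {i s : ℕ} (hs : s ∈ H) (hi : s ∈ idealPow H i) :
    reesAlgebra (gradedMaxIdeal k H) :=
  ⟨monomial i (tpow k hs), reesAlgebra.monomial_mem.2 (tpow_mem_pow hs hi)⟩

variable (k) in
/-- The ring homomorphism from `k[T]` to the Rees algebra with `T ↦ t ^ a`, placed in degree one. -/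
noncomputable def polyToRees (ha1 : a ∈ idealPow H 1) :
    k[X] →+* reesAlgebra (gradedMaxIdeal k H) :=
  eval₂RingHom ((algebraMap (semigroupRing k H) _).comp (algebraMap k _)) (reesMonomial k ha ha1)

theorem nsmul_mem_idealPow {a : ℕ} (ha : a ∈ H) (ha0 : a ≠ 0) (i : ℕ) : i • a ∈ idealPow H i := by
  induction i with
  | zero => rw [zero_nsmul]; exact H.zero_mem
  | succ i ih => exact ⟨a, ha, ha0, _, ih, by rw [succ_nsmul']⟩

theorem coe_polyToRees_monomial (ha1 : a ∈ idealPow H 1) (i : ℕ) (c : k) :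
    (polyToRees k ha ha1 (monomial i c) : (semigroupRing k H)[X]) =
      monomial i (c • tpow k (H.nsmul_mem ha i)) := by
  rw [polyToRees, coe_eval₂RingHom, eval₂_monomial, Subalgebra.coe_mul, Subalgebra.coe_pow]
  change C (algebraMap k (semigroupRing k H) c) * (monomial 1 (tpow k ha)) ^ i = _
  rw [monomial_pow, tpow_pow, C_mul_monomial, ← Algebra.smul_def, Nat.one_mul]

theorem coeff_polyToRees (ha1 : a ∈ idealPow H 1) (p : k[X]) (i : ℕ) :
    (polyToRees k ha ha1 p : (semigroupRing k H)[X]).coeff i =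
      p.coeff i • tpow k (H.nsmul_mem ha i) := by
  induction p using Polynomial.induction_on' with
  | add p q hp hq => rw [map_add, Subalgebra.coe_add, coeff_add, coeff_add, hp, hq, add_smul]
  | monomial j c =>
    rw [coe_polyToRees_monomial, coeff_monomial, coeff_monomial]
    split_ifs with h
    · subst h; rfl
    · rw [zero_smul]

variable {G : Type*} [CommRing G] {π : reesAlgebra (gradedMaxIdeal k H) →+* G}
  (hπ : ∀ F, π F = 0 ↔ ∀ i, (F : (semigroupRing k H)[X]).coeff i ∈ gradedMaxIdeal k H ^ (i + 1))

include hπ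

/-- By minimality of `a`, the element ia is too small to lie in (i+1)M. -/
theorem comp_polyToRees_injective (ha1 : a ∈ idealPow H 1) (ha0 : a ≠ 0)
    (hmin : mult H = a) : Function.Injective (π.comp (polyToRees k ha ha1)) := by
  rw [injective_iff_map_eq_zero]
  intro p hp
  rw [RingHom.comp_apply, hπ] at hp
  ext i
  by_contra hne
  rw [coeff_zero] at hne
  have := hp i
  rw [coeff_polyToRees] at this
  have h1 := mul_le_of_mem_idealPow (mem_idealPow_of_mem_pow this (s := i • a)
    (by simpa [tpow] using hne))
  rw [hmin, smul_eq_mul, add_mul] at h1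
  omega

include ha in
theorem isNilpotent_map_reesMonomial (ha0 : a ≠ 0) {i s : ℕ} (hs : s ∈ H) (hi : s ∈ idealPow H i)
    (his : i * a < s) : IsNilpotent (π (reesMonomial k hs hi)) := by
  refine ⟨a, ?_⟩
  rw [← map_pow, hπ]
  intro j
  rw [Subalgebra.coe_pow]
  change ((monomial i (tpow k hs)) ^ a).coeff j ∈ _
  rw [monomial_pow, tpow_pow, coeff_monomial]
  split_ifs with h
  · rw [tpow_mem_pow_iff]
    -- Read as s copies of a, the exponent lies in sM, and s ≥ ia + 1 exceeds the degree ia of the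
    -- power.
    have h1 : a • s = s • a := by rw [smul_eq_mul, smul_eq_mul, mul_comm]
    rw [h1]
    exact idealPow_anti (by omega) (nsmul_mem_idealPow ha ha0 s)
  · exact zero_mem _

theorem map_mem_rangeAddNilpotents_polyToRees (ha1 : a ∈ idealPow H 1) (ha0 : a ≠ 0)
    (hmin : mult H = a) (F : reesAlgebra (gradedMaxIdeal k H)) :
    π F ∈ rangeAddNilpotents (π.comp (polyToRees k ha ha1)) := by
  let T : AddSubmonoid (semigroupRing k H)[X] :=
    ((rangeAddNilpotents (π.comp (polyToRees k ha ha1))).comap π).map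
      (reesAlgebra (gradedMaxIdeal k H)).val
  have hgen : ∀ (c : k) (i s : ℕ) (hs : s ∈ H), s ∈ idealPow H i →
      monomial i (c • tpow k hs) ∈ T := by
    intro c i s hs hi
    have hle := mul_le_of_mem_idealPow hi
    rw [hmin] at hle
    -- In degree i, the exponent s = ia comes from T^i; any larger exponent gives a nilpotent.
    rcases hle.eq_or_lt with h | h
    · refine ⟨polyToRees k ha ha1 (monomial i c), 
        map_mem_rangeAddNilpotents (π.comp (polyToRees k ha ha1)) (monomial i c), ?_⟩
      change (polyToRees k ha ha1 (monomial i c) : (semigroupRing k H)[X]) = _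
      rw [coe_polyToRees_monomial]
      rw [tpow_congr (k := k) hs (H.nsmul_mem ha i) h.symm]
    · refine ⟨algebraMap _ _ (algebraMap k (semigroupRing k H) c) * reesMonomial k hs hi, ?_, ?_⟩
      · rw [SetLike.mem_coe, AddSubmonoid.mem_comap, map_mul]
        exact mul_mem_rangeAddNilpotents _ (isNilpotent_map_reesMonomial ha hπ ha0 hs hi h) _
      · change C (algebraMap k (semigroupRing k H) c) * monomial i (tpow k hs) = _
        rw [C_mul_monomial, Algebra.smul_def]
  have hmono : ∀ i r, r ∈ gradedMaxIdeal k H ^ i → monomial i r ∈ T := by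
    intro i r hr
    replace hr := mem_span_tpow (mem_pow_iff.1 hr)
    -- `T` is only an additive submonoid, so the scalar is carried through the induction.
    suffices ∀ c : k, monomial i (c • r) ∈ T by simpa using this 1
    induction hr using Submodule.span_induction with
    | mem r h =>
      obtain ⟨s, hs, hi, rfl⟩ := h
      exact fun c => hgen c i s hs hi
    | zero => intro c; rw [smul_zero, map_zero]; exact T.zero_mem
    | add x y hx hy ihx ihy =>
      intro c
      rw [smul_add, map_add]
      exact T.add_mem (ihx c) (ihy c)
    | smul d x hx ih =>
      intro c
      rw [smul_smul]
      exact ih (c * d)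
  have hF : (F : (semigroupRing k H)[X]) ∈ T := by
    rw [(F : (semigroupRing k H)[X]).as_sum_support]
    exact T.sum_mem fun i _ => hmono i _ (F.2 i)
  obtain ⟨F', h, hFF'⟩ := hF
  obtain rfl : F' = F := Subtype.ext hFF'
  exact h

theorem map_polyToRees_X_mul_eq_zero (ha1 : a ∈ idealPow H 1) {g : ℕ} (hg : g ∈ H)
    (hg1 : g ∈ idealPow H 1) (hag : a + g ∈ idealPow H 3) :
    π.comp (polyToRees k ha ha1) X * π (reesMonomial k hg hg1) = 0 := by
  rw [RingHom.comp_apply, ← map_mul, hπ]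
  intro j
  rw [polyToRees, coe_eval₂RingHom, eval₂_X, Subalgebra.coe_mul]
  change (monomial 1 (tpow k ha) * monomial 1 (tpow k hg)).coeff j ∈ _
  rw [monomial_mul_monomial, tpow_mul_tpow, coeff_monomial]
  split_ifs with h
  · subst h
    exact tpow_mem_pow _ hag
  · exact zero_mem _

theorem map_reesMonomial_ne_zero {g : ℕ} (hg : g ∈ H) (hg1 : g ∈ idealPow H 1)
    (hgm : g ∈ minGens H) : π (reesMonomial k hg hg1) ≠ 0 := by
  rw [Ne, hπ]
  intro h
  have h1 := h 1
  rw [reesMonomial, coeff_monomial_same, tpow_mem_pow_iff] at h1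
  exact (idealPow_two_iff.1 h1).2.2 hgm

/-- Lowest-term argument: in degree r + i of the product, terms with index of f below r vanish,
those above r are handled by induction on i, and what is left is a unit times t^(ra) times the i-th
coefficient of `F`, where t^(ra) can be cancelled. -/
theorem map_eq_zero_of_polyToRees_mul_eq_zero (ha1 : a ∈ idealPow H 1)
    (hcan : ∀ i s, s ∈ H → a + s ∈ idealPow H (i + 2) → s ∈ idealPow H (i + 1))
    {f : k[X]} (hf : f ≠ 0) (F : reesAlgebra (gradedMaxIdeal k H))
    (hz : π.comp (polyToRees k ha ha1) f * π F = 0) : π F = 0 := by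
  set m := gradedMaxIdeal k H
  have cancel_one : ∀ i (r : semigroupRing k H), tpow k ha * r ∈ m ^ (i + 2) → r ∈ m ^ (i + 1) := by
    intro i r hr
    rw [mem_pow_iff] at hr ⊢
    intro s hs
    refine hcan i s (mem_semigroupRing_iff.1 r.2 s hs) (hr (a + s) ?_)
    change (X ^ a * (r : k[X])).coeff (a + s) ≠ 0
    rwa [add_comm, coeff_X_pow_mul]
  have cancel : ∀ l i (r : semigroupRing k H), tpow k ha ^ l * r ∈ m ^ (l + i + 1) →
      r ∈ m ^ (i + 1) := by
    intro l
    induction l with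
    | zero => intro i r hr; simpa using hr
    | succ l ih =>
      intro i r hr
      refine ih i r (cancel_one _ _ ?_)
      rw [← mul_assoc, ← pow_succ']
      exact (show l + 1 + i + 1 = l + i + 2 by omega) ▸ hr
  rw [RingHom.comp_apply, ← map_mul, hπ] at hz
  rw [hπ]
  set r := f.natTrailingDegree with hr
  intro i
  induction i using Nat.strong_induction_on with
  | _ i ih =>
    have h1 := hz (r + i)
    have hri : (r, i) ∈ Finset.HasAntidiagonal.antidiagonal (r + i) := Finset.HasAntidiagonal.mem_antidiagonal.2 rfl
    rw [Subalgebra.coe_mul, coeff_mul, ← Finset.add_sum_erase _ _ hri] at h1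
    have h2 := (Ideal.add_mem_iff_left _ (Ideal.sum_mem _ fun p hp => ?_)).1 h1
    · simp only [coeff_polyToRees] at h2
      apply cancel r
      have hunit : f.coeff r ≠ 0 := by
        rw [hr, ← Polynomial.trailingCoeff]; exact trailingCoeff_nonzero_iff_nonzero.2 hf
      have h3 := Submodule.smul_mem ((m ^ (r + i + 1)).restrictScalars k) (f.coeff r)⁻¹ h2
      rw [smul_mul_assoc, smul_smul, inv_mul_cancel₀ hunit, one_smul, ← tpow_pow] at h3
      exact h3
    · obtain ⟨hpne, hp⟩ := Finset.mem_erase.1 hp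
      have hp := Finset.HasAntidiagonal.mem_antidiagonal.1 hp
      rcases lt_trichotomy p.1 r with h | h | h
      · rw [coeff_polyToRees, coeff_eq_zero_of_lt_natTrailingDegree h, zero_smul, zero_mul]
        exact zero_mem _
      · exact absurd (Prod.ext h (by simp only; omega)) hpne
      · rw [← hp, add_assoc, pow_add]
        exact Ideal.mul_mem_mul ((polyToRees k ha ha1 f).2 _) (ih p.2 (by omega))

end Graded

end NumSgp

/-! ### The criterion for the tangent cone. -/

namespace NumSgp.ArithmeticPF

variable {k : Type*} [Field k] {H : AddSubmonoid ℕ} {n a h α j b : ℕ}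

theorem not_isCohenMacaulay_iff (A : ArithmeticPF H n a h α) (hjb : IsGenIndex H n a h α j b)
    {G : Type*} [CommRing G] (π : reesAlgebra (gradedMaxIdeal k H) →+* G)
    (hsurj : Function.Surjective π)
    (hπ : ∀ F, π F = 0 ↔
      ∀ i, (F : (semigroupRing k H)[X]).coeff i ∈ gradedMaxIdeal k H ^ (i + 1)) :
    ¬ IsCohenMacaulay G ↔ j = 1 ∧ h = b ∧ b = a + α := by
  obtain ⟨g, hg, hg0, hgb⟩ := A.exists_three_mul_eq hjb
  rw [← A.mem_minGens_iff hjb hgb]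
  have hbH : b ∈ H := (A.of_isGenIndex hjb).1
  have hb0 : b ≠ 0 := fun h0 => by have := (A.of_isGenIndex hjb).2.1; omega
  have ha1 : a ∈ idealPow H 1 := idealPow_one_iff.2 ⟨A.mem, A.ne_zero⟩
  have hs : ∀ z, z ∈ rangeAddNilpotents (π.comp (polyToRees k A.mem ha1)) := by
    intro z
    obtain ⟨F, rfl⟩ := hsurj z
    exact map_mem_rangeAddNilpotents_polyToRees A.mem hπ ha1 A.ne_zero A.mult_eq F
  constructor
  · contrapose!
    intro hgm
    -- `ncard` is 0 on infinite sets, so an embedding dimension of at least 3 gives finiteness.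
    have hfin : (minGens H).Finite := Set.finite_of_ncard_ne_zero (by
      have h1 := A.embDim_eq
      have h2 := A.three_le
      rw [embDim] at h1
      omega)
    have : IsNoetherianRing (semigroupRing k H) := isNoetherianRing_semigroupRing hfin
    have : IsNoetherianRing G := isNoetherianRing_of_surjective _ _ π hsurj
    refine isCohenMacaulay_of_torsionFree _ hs fun f hf z hz => ?_
    obtain ⟨F, rfl⟩ := hsurj z
    exact map_eq_zero_of_polyToRees_mul_eq_zero A.mem hπ ha1
      (fun i s => A.mem_idealPow_of_add_mem hjb hg hg0 hgb hgm) hf F hz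
  · intro hgm
    have hg1 : g ∈ idealPow H 1 := idealPow_one_iff.2 ⟨hg, hg0⟩
    have hag : a + g ∈ idealPow H 3 := ⟨b, hbH, hb0, 2 * b,
      ⟨b, hbH, hb0, b, idealPow_one_iff.2 ⟨hbH, hb0⟩, two_mul b⟩, by omega⟩
    exact not_isCohenMacaulay_of_annihilated _
      (comp_polyToRees_injective A.mem hπ ha1 A.ne_zero A.mult_eq) hs
      _ (map_reesMonomial_ne_zero hπ hg hg1 hgm)
      (map_polyToRees_X_mul_eq_zero A.mem hπ ha1 hg hg1 hag)

end NumSgp.ArithmeticPF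

theorem corollary4p3 {k : Type*} [Field k] (H : AddSubmonoid ℕ)
    (hH : NumSgp.IsNumericalSemigroup H) (n a h α : ℕ)
    (hn : NumSgp.embDim H = n) (hn3 : 3 ≤ n)
    (ha : NumSgp.mult H = a) (hℓ : (a : ℤ) - n + 1 = 2)
    (hst : IsStretchedArtinianLocal
      (NumSgp.semigroupRing k H ⧸ NumSgp.monomialIdeal k H a))
    (hα : 0 < α)
    (hPF : NumSgp.PF H =
      (fun i : ℕ => (h : ℤ) + (i : ℤ) * (α : ℤ)) '' Set.Icc 1 (n - 1)) :
    (∃! p : ℕ × ℕ, NumSgp.IsGenIndex H n a h α p.1 p.2) ∧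
    ∀ j b : ℕ, NumSgp.IsGenIndex H n a h α j b →
      (¬ IsCohenMacaulay (AssocGradedRing (NumSgp.gradedMaxIdeal k H)) ↔
        j = 1 ∧ h = b ∧ b = a + α) := by

  have A : NumSgp.ArithmeticPF H n a h α := ⟨hH, hn, hn3, ha, by omega, hα, hPF⟩
  refine ⟨A.existsUnique_genIndex, fun j b hjb => A.not_isCohenMacaulay_iff hjb
    (Ideal.Quotient.mk _) Ideal.Quotient.mk_surjective fun F => ?_⟩
  rw [Ideal.Quotient.eq_zero_iff_mem, mem_map_algebraMap_reesAlgebra_iff]
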